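/- Let $S=\begin{pmatrix}A&B\\ C&D\end{pmatrix}\in\mathrm{Sp}(d,\mathbb R)$ be a symplectic matrix with blocks $A,B,C,D\in\mathbb R^{d\times d}$, and let $\hat S$ be a metaplectic operator with projection $S$, i.e. a unitary operator on $L^2(\mathbb R^d)$ such that $W(\hat Sf,\hat Sg)(z)=W(f,g)(S^{-1}z)$ for all $f,g\in L^2(\mathbb R^d)$ and $z\in\mathbb R^{2d}$, where $$W(f,g)(x,\xi)=\int_{\mathbb R^d}f\left(x+\tfrac t2\right)\overline{g\left(x-\tfrac t2\right)}\,e^{-2\pi i\xi\cdot t}\,dt .$$ Assume that $1\le r=\operatorname{rank}B<d$, and write $R(B)$ for the range of $B$. Then $$\mathbb R^d=\ker(B)^\perp\oplus D^T(R(B)^\perp)=R(B)\oplus R(B)^\perp,$$ and $D^T$ is injective on $R(B)^\perp$. Write $x=x_1+x_2$ with $x_1\in\ker(B)^\perp$, $x_2\in D^T(R(B)^\perp)$, write $\xi=\xi_1+\xi_2$ with $\xi_1\in R(B)$, $\xi_2\in R(B)^\perp$, and let $D^{-T}$ denote the inverse of $D^T|_{R(B)^\perp}$. For every compact set $K\subseteq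 D^T(R(B)^\perp)$ there is a function $f\in L^2(\mathbb R^d)$ such that $$\operatorname{supp}(f)\subseteq\{x: x_2\in K\},\qquad \operatorname{supp}(\hat Sf)\subseteq\{\xi:\xi_2\in D^{-T}(K)\},$$ and $f\neq0$ whenever $K$ has positive $(d-r)$-dimensional Lebesgue measure in $D^T(R(B)^\perp)$. Here $\operatorname{supp}$ is the essential support: the complement of the largest open set on which the function vanishes almost everywhere. -/

import Mathlib

open MeasureTheory

noncomputable section

/-- `ℝᵈ` with the Euclidean norm. -/
abbrev RSpace (d : ℕ) : Type := EuclideanSpace ℝ (Fin d)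

/-- `L²(ℝᵈ)`, complex valued, with respect to Lebesgue measure. -/
abbrev L2Space (d : ℕ) : Type := Lp ℂ 2 (volume : Measure (RSpace d))

/-- The action `z ↦ T z` of a real `2d × 2d` matrix on phase space `ℝᵈ × ℝᵈ`. -/
def phaseSpaceMap {d : ℕ} (T : Matrix (Fin d ⊕ Fin d) (Fin d ⊕ Fin d) ℝ)
    (z : RSpace d × RSpace d) : RSpace d × RSpace d :=
  (WithLp.toLp 2 (fun i => T.mulVec (Sum.elim z.1.ofLp z.2.ofLp) (Sum.inl i)),
   WithLp.toLp 2 (fun i => T.mulVec (Sum.elim z.1.ofLp z.2.ofLp) (Sum.inr i)))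

/-- The cross-Wigner distribution
`W(f,g)(x,ξ) = ∫ f(x + t/2) conj(g(x - t/2)) exp(-2πi ξ·t) dt`. -/
def crossWigner {d : ℕ} (f g : RSpace d → ℂ) (z : RSpace d × RSpace d) : ℂ :=
  ∫ t : RSpace d,
    f (z.1 + (1 / 2 : ℝ) • t) * (starRingEnd ℂ) (g (z.1 - (1 / 2 : ℝ) • t)) *
      Complex.exp (-(2 * (Real.pi : ℂ) * Complex.I * ((inner ℝ z.2 t : ℝ) : ℂ)))

/-- The unitary operator `U` on `L²(ℝᵈ)` is a metaplectic operator with projection `S`: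
`W(Uf,Ug)(z) = W(f,g)(S⁻¹ z)` for all `f, g ∈ L²(ℝᵈ)` and all `z ∈ ℝ²ᵈ`. -/
def IsMetaplectic {d : ℕ} (S : Matrix (Fin d ⊕ Fin d) (Fin d ⊕ Fin d) ℝ)
    (U : L2Space d ≃ₗᵢ[ℂ] L2Space d) : Prop :=
  S ∈ Matrix.symplecticGroup (Fin d) ℝ ∧
    ∀ (f g : L2Space d) (z : RSpace d × RSpace d),
      crossWigner (U f) (U g) z = crossWigner f g (phaseSpaceMap S⁻¹ z)

/-- The (essential) support of an `L²` function: a point lies outside it exactly when the function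
vanishes almost everywhere on some neighbourhood of the point. -/
def essSupport {d : ℕ} (f : L2Space d) : Set (RSpace d) :=
  {x | ∀ V ∈ nhds x, ¬ ∀ᵐ y ∂(volume.restrict V), f y = 0}

/-- The kernel of a matrix. -/
def matKer {d : ℕ} (B : Matrix (Fin d) (Fin d) ℝ) : Submodule ℝ (RSpace d) :=
  LinearMap.ker (Matrix.toEuclideanLin B)

/-- The range of a matrix. -/
def matRange {d : ℕ} (B : Matrix (Fin d) (Fin d) ℝ) : Submodule ℝ (RSpace d) :=
  LinearMap.range (Matrix.toEuclideanLin B)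

/-- The subspace `Dᵀ(R(B)^⊥)`. -/
def transComplement {d : ℕ} (B D : Matrix (Fin d) (Fin d) ℝ) : Submodule ℝ (RSpace d) :=
  (matRange B)ᗮ.map (Matrix.toEuclideanLin D.transpose)

/-- `D^{-T}(K)`, the image of `K ⊆ Dᵀ(R(B)^⊥)` under the inverse of `Dᵀ` restricted
to `R(B)^⊥`. -/
def transPreimage {d : ℕ} (B D : Matrix (Fin d) (Fin d) ℝ) (K : Set (RSpace d)) :
    Set (RSpace d) :=
  {y | y ∈ (matRange B)ᗮ ∧ Matrix.toEuclideanLin D.transpose y ∈ K}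

/-- The cylinder of all `x = x₁ + x₂` with `x₁ ∈ L` and `x₂ ∈ K`. When `ℝᵈ = L ⊕ L'` and
`K ⊆ L'`, this is the set of all `x` whose `L'`-component lies in `K`. -/
def cylinderOver {d : ℕ} (L : Submodule ℝ (RSpace d)) (K : Set (RSpace d)) : Set (RSpace d) :=
  {x | ∃ x₁ ∈ L, ∃ x₂ ∈ K, x = x₁ + x₂}

/-- Lebesgue measure of a linear subspace with its inherited Euclidean structure: the translation
invariant measure giving mass one to the cube spanned by an orthonormal basis. (The instance
`volume` on the subtype would be the restriction of `d`-dimensional Lebesgue measure instead.) -/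
def subspaceLebesgue {d : ℕ} (L : Submodule ℝ (RSpace d)) : Measure L :=
  (stdOrthonormalBasis ℝ L).toBasis.addHaar

end

/-!
A function `f` is essentially supported in a closed convex set `E` if and only if `W(f,f)` vanishes
over all positions outside `E`: midpoints of points of `E` stay in `E`, and conversely, by Fourier
inversion, `W(f,f)(x,·) = 0` for all `x` in a ball forces `f(u) f(v) = 0` for almost all `u, v` in
that ball. Since the position component of `S⁻¹(x,ξ)` is `Dᵀx - Bᵀξ`, a linear map `P` that kills
`R(Bᵀ) = ker(B)^⊥` does not see `ξ`, and `f` lives in `P⁻¹(H)` if and only if `Ŝf` lives in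
`(P Dᵀ)⁻¹(H)`, for every closed convex `H`.

A general closed `K` is not an intersection of convex sets; it is instead recovered from the balls
`H` disjoint from it. If `f` lives in `P⁻¹(K)`, then `f` is orthogonal to all functions living in
`P⁻¹(H)`, so by unitarity `Ŝf` is orthogonal to all functions living in `(P Dᵀ)⁻¹(H)`, that is,
`Ŝf` vanishes there. The theorem is the case where `P` projects onto `Dᵀ(R(B)^⊥)` along
`ker(B)^⊥`.
-/

section Symplectic

open Matrix

variable {l R : Type*} [DecidableEq l] [Fintype l] [CommRing R] {A B C D : Matrix l l R}

theorem fromBlocks_mem_symplecticGroup_iff' :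
    fromBlocks A B C D ∈ symplecticGroup l R ↔
      A * Bᵀ = B * Aᵀ ∧ C * Dᵀ = D * Cᵀ ∧ A * Dᵀ - B * Cᵀ = 1 := by
  rw [← SymplecticGroup.transpose_mem_iff, fromBlocks_transpose, SymplecticGroup.fromBlocks_mem_iff]
  simp only [transpose_transpose]

theorem inv_fromBlocks_of_mem_symplecticGroup (hS : fromBlocks A B C D ∈ symplecticGroup l R) :
    (fromBlocks A B C D)⁻¹ = fromBlocks Dᵀ (-Bᵀ) (-Cᵀ) Aᵀ := by
  rw [SymplecticGroup.inv_eq_symplectic_inv _ hS]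
  simp [J, fromBlocks_transpose, fromBlocks_neg, fromBlocks_multiply]

end Symplectic

theorem isCompl_map_of_isCompl_comap {R M N : Type*} [Ring R] [AddCommGroup M] [Module R M]
    [AddCommGroup N] [Module R N] {f : M →ₗ[R] N} {p : Submodule R N} {q : Submodule R M}
    (hpq : IsCompl (p.comap f) q) (hp : LinearMap.range f ⊔ p = ⊤) : IsCompl p (q.map f) := by
  refine ⟨Submodule.disjoint_def.mpr ?_, codisjoint_iff.mpr (top_le_iff.mp ?_)⟩
  · rintro _ hp ⟨y, hq, rfl⟩
    rw [Submodule.disjoint_def.mp hpq.disjoint y hp hq, map_zero]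
  · calc ⊤ = (p.comap f).map f ⊔ q.map f ⊔ p := by
          rw [← Submodule.map_sup, hpq.sup_eq_top, Submodule.map_top, hp]
      _ ≤ p ⊔ q.map f := by
          rw [sup_right_comm]
          exact sup_le_sup_right (sup_le (Submodule.map_comap_le f p) le_rfl) _

section SymplecticSubspaces

open Matrix

variable {d : ℕ} {A B C D : Matrix (Fin d) (Fin d) ℝ}

theorem orthogonal_matKer (B : Matrix (Fin d) (Fin d) ℝ) : (matKer B)ᗮ = matRange Bᵀ := by
  rw [matKer, LinearMap.orthogonal_ker, ← toEuclideanLin_conjTranspose_eq_adjoint,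
    conjTranspose_eq_transpose_of_trivial, matRange]

theorem comap_transpose_orthogonal_matKer
    (hS : fromBlocks A B C D ∈ symplecticGroup (Fin d) ℝ) :
    (matKer B)ᗮ.comap (toEuclideanLin Dᵀ) = matRange B := by
  obtain ⟨hAB, -, hAD⟩ := fromBlocks_mem_symplecticGroup_iff'.mp hS
  obtain ⟨-, hBD, -⟩ := SymplecticGroup.fromBlocks_mem_iff.mp hS
  rw [orthogonal_matKer]
  ext y
  constructor
  · rintro ⟨w, hw⟩
    refine ⟨toEuclideanLin Aᵀ w - toEuclideanLin Cᵀ y, ?_⟩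
    calc toEuclideanLin B (toEuclideanLin Aᵀ w - toEuclideanLin Cᵀ y)
        = toEuclideanLin A (toEuclideanLin Bᵀ w) - toEuclideanLin (B * Cᵀ) y := by
          simp only [map_sub, ← LinearMap.comp_apply, ← toLpLin_mul_same, hAB]
      _ = toEuclideanLin (A * Dᵀ - B * Cᵀ) y := by
          rw [hw, map_sub, LinearMap.sub_apply, toLpLin_mul_same 2 A,
            LinearMap.comp_apply]
      _ = y := by simp [hAD]
  · rintro ⟨w, rfl⟩
    refine ⟨toEuclideanLin D w, ?_⟩
    simp only [← LinearMap.comp_apply, ← toLpLin_mul_same, hBD]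

theorem range_transpose_sup_orthogonal_matKer
    (hS : fromBlocks A B C D ∈ symplecticGroup (Fin d) ℝ) :
    LinearMap.range (toEuclideanLin Dᵀ) ⊔ (matKer B)ᗮ = ⊤ := by
  have hDA : Dᵀ * A - Bᵀ * C = 1 := by
    have h := (SymplecticGroup.fromBlocks_mem_iff.mp hS).2.2
    simpa using congrArg transpose h
  rw [orthogonal_matKer, Submodule.eq_top_iff']
  intro x
  have hx : x = toEuclideanLin Dᵀ (toEuclideanLin A x) +
      toEuclideanLin Bᵀ (-toEuclideanLin C x) := by
    simp [← LinearMap.comp_apply, ← toLpLin_mul_same, ← sub_eq_add_neg, ← LinearMap.sub_apply,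
      ← map_sub, hDA]
  rw [hx]
  exact Submodule.add_mem_sup ⟨_, rfl⟩ ⟨_, rfl⟩

theorem isCompl_orthogonal_matKer_transComplement
    (hS : fromBlocks A B C D ∈ symplecticGroup (Fin d) ℝ) :
    IsCompl (matKer B)ᗮ (transComplement B D) := by
  refine isCompl_map_of_isCompl_comap ?_ (range_transpose_sup_orthogonal_matKer hS)
  rw [comap_transpose_orthogonal_matKer hS]
  exact Submodule.isCompl_orthogonal _

theorem injOn_transpose_orthogonal_matRange
    (hS : fromBlocks A B C D ∈ symplecticGroup (Fin d) ℝ) :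
    Set.InjOn (toEuclideanLin Dᵀ) ((matRange B)ᗮ : Set (RSpace d)) := by
  have hker : LinearMap.ker (toEuclideanLin Dᵀ) ≤ matRange B := by
    rw [← comap_transpose_orthogonal_matKer hS]
    exact Submodule.comap_mono bot_le
  exact LinearMap.injOn_of_disjoint_ker subset_rfl
    ((Submodule.orthogonal_disjoint _).symm.mono_right hker)

theorem preimage_transpose_cylinderOver
    (hS : fromBlocks A B C D ∈ symplecticGroup (Fin d) ℝ) {K : Set (RSpace d)}
    (hK : K ⊆ transComplement B D) :
    toEuclideanLin Dᵀ ⁻¹' cylinderOver (matKer B)ᗮ K =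
      cylinderOver (matRange B) (transPreimage B D K) := by
  rw [← comap_transpose_orthogonal_matKer hS]
  ext x
  constructor
  · rintro ⟨l, hl, k, hk, hx⟩
    obtain ⟨y, hy, rfl⟩ := hK hk
    exact ⟨x - y, by simpa [hx] using hl, y, ⟨hy, hk⟩, (sub_add_cancel x y).symm⟩
  · rintro ⟨x₁, h₁, x₂, ⟨-, h₂⟩, rfl⟩
    exact ⟨_, h₁, _, h₂, map_add _ _ _⟩

end SymplecticSubspaces

section PhaseSpace

open Matrix

variable {d : ℕ}

theorem phaseSpaceMap_mul (S T : Matrix (Fin d ⊕ Fin d) (Fin d ⊕ Fin d) ℝ)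
    (z : RSpace d × RSpace d) :
    phaseSpaceMap (S * T) z = phaseSpaceMap S (phaseSpaceMap T z) := by
  have h : Sum.elim (phaseSpaceMap T z).1.ofLp (phaseSpaceMap T z).2.ofLp =
      T *ᵥ Sum.elim z.1.ofLp z.2.ofLp := by
    ext (i | i) <;> rfl
  simp only [phaseSpaceMap, ← mulVec_mulVec] at h ⊢
  rw [h]

theorem phaseSpaceMap_one (z : RSpace d × RSpace d) :
    phaseSpaceMap (1 : Matrix (Fin d ⊕ Fin d) (Fin d ⊕ Fin d) ℝ) z = z := by
  simp [phaseSpaceMap]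

theorem phaseSpaceMap_inv_surjective {S : Matrix (Fin d ⊕ Fin d) (Fin d ⊕ Fin d) ℝ}
    (hS : IsUnit S.det) : Function.Surjective (phaseSpaceMap S⁻¹) := fun z =>
  ⟨phaseSpaceMap S z, by rw [← phaseSpaceMap_mul, nonsing_inv_mul S hS, phaseSpaceMap_one]⟩

theorem fst_phaseSpaceMap_inv_fromBlocks {A B C D : Matrix (Fin d) (Fin d) ℝ}
    (hS : fromBlocks A B C D ∈ symplecticGroup (Fin d) ℝ) (z : RSpace d × RSpace d) :
    (phaseSpaceMap (fromBlocks A B C D)⁻¹ z).1 =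
      toEuclideanLin Dᵀ z.1 - toEuclideanLin Bᵀ z.2 := by
  ext i
  simp [phaseSpaceMap, inv_fromBlocks_of_mem_symplecticGroup hS, fromBlocks_mulVec, toLpLin_apply,
    neg_mulVec, sub_eq_add_neg]

end PhaseSpace

section Fourier

open FourierTransform SchwartzMap

variable {E F : Type*} [NormedAddCommGroup E] [InnerProductSpace ℝ E] [FiniteDimensional ℝ E]
  [MeasurableSpace E] [BorelSpace E] [NormedAddCommGroup F] [NormedSpace ℂ F] [CompleteSpace F]

theorem ae_eq_zero_of_fourier_eq_zero {h : E → F} (hh : Integrable h) (hF : 𝓕 h = 0) :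
    h =ᵐ[volume] 0 := by
  have hSchwartz (φ : 𝓢(E, ℂ)) : ∫ x, φ x • h x = 0 := by
    let ψ : 𝓢(E, ℂ) := 𝓕⁻ φ
    calc ∫ x, φ x • h x = ∫ x, 𝓕 (⇑ψ) x • h x := by
          rw [← SchwartzMap.fourier_coe, FourierTransform.fourier_fourierInv_eq]
      _ = ∫ x, ψ x • 𝓕 h x := by
          simpa using! VectorFourier.integral_fourierIntegral_smul_eq_flip (L := innerₗ E)
            Real.continuous_fourierChar continuous_inner ψ.integrable hh
      _ = 0 := by simp [hF]
  have hL := memLp_one_iff_integrable.mpr hh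
  have hker : hL.toLp ∈ (Lp.toTemperedDistributionCLM F volume 1).ker := by
    rw [LinearMap.mem_ker]
    ext φ
    refine (Lp.toTemperedDistribution_apply _ φ).trans
      (Eq.trans (integral_congr_ae ?_) (hSchwartz φ))
    filter_upwards [hL.coeFn_toLp] with x hx
    rw [hx]
  rw [Lp.ker_toTemperedDistributionCLM_eq_bot] at hker
  exact hL.coeFn_toLp.symm.trans (Lp.eq_zero_iff_ae_eq_zero.mp hker)

end Fourier

section Midpoint

variable {E : Type*} [NormedAddCommGroup E] [NormedSpace ℝ E] [FiniteDimensional ℝ E]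
  [MeasurableSpace E] [BorelSpace E] {μ : Measure E} [μ.IsAddHaarMeasure] {N C : Set E}

theorem ae_notMem_or_notMem_of_notMem_convex (hC : Convex ℝ C) (hN : ∀ᵐ x ∂μ, x ∉ C → x ∉ N)
    {x : E} (hx : x ∉ C) :
    ∀ᵐ t ∂μ, x + (1 / 2 : ℝ) • t ∉ N ∨ x - (1 / 2 : ℝ) • t ∉ N := by
  have hhalf := Measure.quasiMeasurePreserving_smul μ (r := (1 / 2 : ℝ)) (by norm_num)
  have hadd := ((measurePreserving_add_left μ x).quasiMeasurePreserving.comp hhalf).ae hN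
  have hsub := ((Measure.measurePreserving_sub_left μ x).quasiMeasurePreserving.comp hhalf).ae hN
  filter_upwards [hadd, hsub] with t hadd hsub
  by_contra! h
  have hmid := hC.midpoint_mem (not_imp_not.mp hadd h.1) (not_imp_not.mp hsub h.2)
  exact hx (by simpa using hmid)

theorem ae_notMem_of_forall_mem_convex (hC : Convex ℝ C) (hCm : MeasurableSet C)
    (hN : MeasurableSet N)
    (h : ∀ x ∈ C, ∀ᵐ t ∂μ, x + (1 / 2 : ℝ) • t ∉ N ∨ x - (1 / 2 : ℝ) • t ∉ N) :
    ∀ᵐ x ∂μ, x ∈ C → x ∉ N := by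
  let G : Set (E × E) :=
    {p | p.1 ∈ C → p.1 + (1 / 2 : ℝ) • p.2 ∉ N ∨ p.1 - (1 / 2 : ℝ) • p.2 ∉ N}
  have hG : MeasurableSet G := by
    refine .imp (measurable_fst hCm) (.union (.compl ?_) (.compl ?_))
    · exact (by fun_prop : Measurable fun p : E × E => p.1 + (1 / 2 : ℝ) • p.2) hN
    · exact (by fun_prop : Measurable fun p : E × E => p.1 - (1 / 2 : ℝ) • p.2) hN
  let φ : E × E →ₗ[ℝ] E × E :=
    ((1 / 2 : ℝ) • (LinearMap.fst ℝ E E + LinearMap.snd ℝ E E)).prod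
      (LinearMap.fst ℝ E E - LinearMap.snd ℝ E E)
  have hφ : Function.Surjective φ := fun p =>
    ⟨(p.1 + (1 / 2 : ℝ) • p.2, p.1 - (1 / 2 : ℝ) • p.2), by
      ext <;> simp [φ] <;> module⟩
  have hGae : ∀ᵐ p ∂μ.prod μ, φ p ∈ G := by
    rw [ae_comp_linearMap_mem_iff φ (μ.prod μ) (μ.prod μ) hφ hG,
      Measure.ae_prod_mem_iff_ae_ae_mem hG]
    refine .of_forall fun x => ?_
    by_cases hx : x ∈ C
    · filter_upwards [h x hx] with t ht _ using ht
    · exact .of_forall fun t hx' => absurd hx' hx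
  have hprod : (μ.prod μ) ((C ∩ N) ×ˢ (C ∩ N)) = 0 := by
    rw [measure_eq_zero_iff_ae_notMem]
    filter_upwards [hGae] with p hp hpN
    have hmid : (φ p).1 ∈ C := by
      simpa [φ, midpoint_eq_smul_add] using hC.midpoint_mem hpN.1.1 hpN.2.1
    have h₁ : (φ p).1 + (1 / 2 : ℝ) • (φ p).2 = p.1 := by simp [φ]; module
    have h₂ : (φ p).1 - (1 / 2 : ℝ) • (φ p).2 = p.2 := by simp [φ]; module
    have hpG := hp hmid
    rw [h₁, h₂] at hpG
    exact hpG.elim (· hpN.1.2) (· hpN.2.2)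
  have hCN : μ (C ∩ N) = 0 := by simpa [Measure.prod_prod] using hprod
  filter_upwards [measure_eq_zero_iff_ae_notMem.mp hCN] with x hx hxC hxN using hx ⟨hxC, hxN⟩

end Midpoint

section EssSupport

variable {d : ℕ} {E : Set (RSpace d)}

theorem essSupport_subset_iff {f : L2Space d} (hE : IsClosed E) :
    essSupport f ⊆ E ↔ ∀ᵐ x, x ∉ E → f x = 0 := by
  constructor
  · intro h
    refine measure_null_of_locally_null _ fun x hx => ?_
    obtain ⟨hxE, -⟩ : x ∉ E ∧ f x ≠ 0 := by simpa using hx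
    obtain ⟨V, hV, hfV⟩ : ∃ V ∈ nhds x, ∀ᵐ y ∂(volume.restrict V), f y = 0 := by
      simpa [essSupport] using mt (@h x) hxE
    refine ⟨_, inter_mem_nhdsWithin _ hV, nonpos_iff_eq_zero.mp ?_⟩
    calc volume ({y | y ∉ E → f y = 0}ᶜ ∩ V)
        ≤ volume.restrict V {y | y ∉ E → f y = 0}ᶜ := Measure.le_restrict_apply _ _
      _ ≤ volume.restrict V {y | f y = 0}ᶜ :=
          measure_mono (Set.compl_subset_compl.mpr fun y hy _ => hy)
      _ = 0 := hfV
  · intro h x hx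
    by_contra hxE
    exact hx _ (hE.isOpen_compl.mem_nhds hxE) ((ae_restrict_iff' hE.measurableSet.compl).mpr h)

theorem exists_ne_zero_essSupport_subset (hE : IsClosed E)
    (hpos : volume E ≠ 0) : ∃ f : L2Space d, f ≠ 0 ∧ essSupport f ⊆ E := by
  obtain ⟨s, hs, hsE, hs0, hsfin⟩ :=
    Measure.exists_subset_measure_lt_top hE.measurableSet (pos_iff_ne_zero.mpr hpos)
  refine ⟨indicatorConstLp 2 hs hsfin.ne 1, ?_, (essSupport_subset_iff hE).mpr ?_⟩
  · rw [← norm_ne_zero_iff, norm_indicatorConstLp two_ne_zero ENNReal.ofNat_ne_top, norm_one,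
      one_mul]
    exact (Real.rpow_pos_of_pos (ENNReal.toReal_pos hs0.ne' hsfin.ne) _).ne'
  · filter_upwards [indicatorConstLp_coeFn_notMem (p := 2) (hs := hs) (hμs := hsfin.ne)
      (c := (1 : ℂ))] with x hx hxE
    exact hx fun hxs => hxE (hsE hxs)

end EssSupport

section Wigner

variable {d : ℕ}

theorem crossWigner_eq_fourier (f g : RSpace d → ℂ) (z : RSpace d × RSpace d) :
    crossWigner f g z = FourierTransform.fourier (fun t : RSpace d =>
      f (z.1 + (1 / 2 : ℝ) • t) * (starRingEnd ℂ) (g (z.1 - (1 / 2 : ℝ) • t))) z.2 := by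
  rw [Real.fourier_eq', crossWigner]
  congr with t
  rw [smul_eq_mul, mul_comm, real_inner_comm]
  congr 2
  push_cast
  ring

theorem integrable_mul_conj_reflection {f g : RSpace d → ℂ} (hf : MemLp f 2) (hg : MemLp g 2)
    (x : RSpace d) :
    Integrable fun t : RSpace d =>
      f (x + (1 / 2 : ℝ) • t) * (starRingEnd ℂ) (g (x - (1 / 2 : ℝ) • t)) := by
  have hadd := hf.comp_measurePreserving (measurePreserving_add_left volume x)
  have hsub := hg.comp_measurePreserving (Measure.measurePreserving_sub_left volume x)
  exact (hadd.integrable_mul hsub.star).comp_smul (by norm_num : (1 / 2 : ℝ) ≠ 0)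

theorem forall_crossWigner_eq_zero_iff {f g : RSpace d → ℂ} (hf : MemLp f 2) (hg : MemLp g 2)
    (x : RSpace d) :
    (∀ ξ, crossWigner f g (x, ξ) = 0) ↔
      ∀ᵐ t : RSpace d, f (x + (1 / 2 : ℝ) • t) = 0 ∨ g (x - (1 / 2 : ℝ) • t) = 0 := by
  constructor
  · intro h
    have hae := ae_eq_zero_of_fourier_eq_zero (integrable_mul_conj_reflection hf hg x)
      (funext fun ξ => (crossWigner_eq_fourier f g (x, ξ)).symm.trans (h ξ))
    filter_upwards [hae] with t ht
    simpa using ht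
  · intro h ξ
    refine integral_eq_zero_of_ae ?_
    filter_upwards [h] with t ht
    simpa using ht

theorem essSupport_subset_iff_crossWigner_eq_zero {f : L2Space d} {E : Set (RSpace d)}
    (hE : IsClosed E) (hconv : Convex ℝ E) :
    essSupport f ⊆ E ↔ ∀ z : RSpace d × RSpace d, z.1 ∉ E → crossWigner f f z = 0 := by
  have hW (x : RSpace d) := forall_crossWigner_eq_zero_iff (Lp.memLp f) (Lp.memLp f) x
  constructor
  · rintro h ⟨x, ξ⟩ hx
    refine (hW x).mpr ?_ ξ
    have hN : ∀ᵐ y, y ∉ E → y ∉ Function.support f := by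
      simpa using (essSupport_subset_iff hE).mp h
    simpa using ae_notMem_or_notMem_of_notMem_convex hconv hN hx
  · intro h x hx
    by_contra hxE
    obtain ⟨r, hr, hrE⟩ := Metric.isOpen_iff.mp hE.isOpen_compl x hxE
    have hf : Measurable f := (Lp.stronglyMeasurable f).measurable
    have hball : ∀ᵐ y, y ∈ Metric.ball x r → y ∉ Function.support f := by
      refine ae_notMem_of_forall_mem_convex (convex_ball x r) measurableSet_ball
        (hf (measurableSet_singleton 0).compl) fun y hy => ?_
      simpa using (hW y).mp fun ξ => h (y, ξ) (hrE hy)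
    refine hx _ (Metric.ball_mem_nhds x hr) ((ae_restrict_iff' measurableSet_ball).mpr ?_)
    simpa using hball

end Wigner

section L2

variable {X G : Type*} [MeasurableSpace X] {μ : Measure X} (𝕜 : Type*) [RCLike 𝕜]
  [NormedAddCommGroup G] [InnerProductSpace 𝕜 G]

theorem inner_eq_zero_of_ae_eq_zero_or_eq_zero {f g : Lp G 2 μ} (h : ∀ᵐ x ∂μ, f x = 0 ∨ g x = 0) :
    inner 𝕜 f g = 0 := by
  rw [L2.inner_def]
  refine integral_eq_zero_of_ae ?_
  filter_upwards [h] with x hx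
  rcases hx with hx | hx <;> simp [hx]

theorem ae_eq_zero_on_of_forall_inner_eq_zero {f : Lp G 2 μ} {s : Set X} (hs : MeasurableSet s)
    (h : ∀ g : Lp G 2 μ, (∀ᵐ x ∂μ, x ∉ s → g x = 0) → inner 𝕜 f g = 0) :
    ∀ᵐ x ∂μ, x ∈ s → f x = 0 := by
  have hind := (Lp.memLp f).indicator hs
  let g : Lp G 2 μ := hind.toLp
  have hg : g =ᵐ[μ] s.indicator f := hind.coeFn_toLp
  have hfg : inner 𝕜 f g = 0 := h g <| by
    filter_upwards [hg] with x hx hxs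
    rw [hx, Set.indicator_of_notMem hxs]
  have hgg : inner 𝕜 g g = 0 := by
    rw [← hfg, L2.inner_def, L2.inner_def]
    refine integral_congr_ae ?_
    filter_upwards [hg] with x hx
    by_cases hxs : x ∈ s <;> simp [hx, hxs]
  have hg0 : g =ᵐ[μ] 0 := Lp.eq_zero_iff_ae_eq_zero.mp (inner_self_eq_zero.mp hgg)
  filter_upwards [hg, hg0] with x hx hx0 hxs
  rw [← Set.indicator_of_mem hxs f, ← hx, hx0, Pi.zero_apply]

end L2

namespace IsMetaplectic

open Matrix

variable {d : ℕ} {A B C D : Matrix (Fin d) (Fin d) ℝ} {U : L2Space d ≃ₗᵢ[ℂ] L2Space d}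
  {F : Type*} [NormedAddCommGroup F] [NormedSpace ℝ F] {P : RSpace d →L[ℝ] F}

theorem essSupport_subset_preimage_iff_of_convex
    (hU : IsMetaplectic (fromBlocks A B C D) U) (hP : ∀ y, P (toEuclideanLin Bᵀ y) = 0)
    {H : Set F} (hH : IsClosed H) (hconv : Convex ℝ H) (f : L2Space d) :
    essSupport f ⊆ P ⁻¹' H ↔ essSupport (U f) ⊆ toEuclideanLin Dᵀ ⁻¹' (P ⁻¹' H) := by
  have hD : Continuous (toEuclideanLin Dᵀ) := LinearMap.continuous_of_finiteDimensional _
  have hclosed : IsClosed (P ⁻¹' H) := hH.preimage P.continuous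
  have hPconv : Convex ℝ (P ⁻¹' H) := hconv.linear_preimage P.toLinearMap
  have hfst (z : RSpace d × RSpace d) :
      (phaseSpaceMap (fromBlocks A B C D)⁻¹ z).1 ∈ P ⁻¹' H ↔
        z.1 ∈ toEuclideanLin Dᵀ ⁻¹' (P ⁻¹' H) := by
    simp [fst_phaseSpaceMap_inv_fromBlocks hU.1, hP]
  have hdet : IsUnit (fromBlocks A B C D).det := SymplecticGroup.symplectic_det hU.1
  rw [essSupport_subset_iff_crossWigner_eq_zero hclosed hPconv,
    essSupport_subset_iff_crossWigner_eq_zero (hclosed.preimage hD) (hPconv.linear_preimage _),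
    (phaseSpaceMap_inv_surjective hdet).forall]
  simp only [hU.2, hfst]

theorem essSupport_subset_preimage (hU : IsMetaplectic (fromBlocks A B C D) U)
    (hP : ∀ y, P (toEuclideanLin Bᵀ y) = 0) {K : Set F} (hK : IsClosed K) {f : L2Space d}
    (hf : essSupport f ⊆ P ⁻¹' K) :
    essSupport (U f) ⊆ toEuclideanLin Dᵀ ⁻¹' (P ⁻¹' K) := by
  intro x hx
  by_contra hxK
  obtain ⟨r, hr, hrK⟩ := Metric.nhds_basis_closedBall.mem_iff.mp (hK.isOpen_compl.mem_nhds hxK)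
  let H := Metric.closedBall (P (toEuclideanLin Dᵀ x)) r
  have hD : Continuous (toEuclideanLin Dᵀ) := LinearMap.continuous_of_finiteDimensional _
  have hH : IsClosed H := Metric.isClosed_closedBall
  have hPH : IsClosed (P ⁻¹' H) := hH.preimage P.continuous
  have hDPH : IsClosed (toEuclideanLin Dᵀ ⁻¹' (P ⁻¹' H)) := hPH.preimage hD
  have horth (g : L2Space d) (hg : essSupport (U g) ⊆ toEuclideanLin Dᵀ ⁻¹' (P ⁻¹' H)) :
      inner ℂ (U f) (U g) = 0 := by
    rw [U.inner_map_map]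
    have hgH := (hU.essSupport_subset_preimage_iff_of_convex hP hH (convex_closedBall _ _) g).mpr hg
    refine inner_eq_zero_of_ae_eq_zero_or_eq_zero ℂ ?_
    filter_upwards [(essSupport_subset_iff (hK.preimage P.continuous)).mp hf,
      (essSupport_subset_iff hPH).mp hgH] with y hfy hgy
    by_cases hy : P y ∈ H
    · exact .inl (hfy (hrK hy))
    · exact .inr (hgy hy)
  have hnull : ∀ᵐ y, y ∈ toEuclideanLin Dᵀ ⁻¹' (P ⁻¹' H) → U f y = 0 := by
    refine ae_eq_zero_on_of_forall_inner_eq_zero ℂ hDPH.measurableSet fun g hg => ?_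
    obtain ⟨g, rfl⟩ := U.surjective g
    exact horth g ((essSupport_subset_iff hDPH).mpr hg)
  have hnhds : toEuclideanLin Dᵀ ⁻¹' (P ⁻¹' H) ∈ nhds x :=
    (P.continuous.comp hD).continuousAt (Metric.closedBall_mem_nhds _ hr)
  exact hx _ hnhds ((ae_restrict_iff' hDPH.measurableSet).mpr hnull)

end IsMetaplectic

section Cylinder

variable {d : ℕ} {L T : Submodule ℝ (RSpace d)} {K : Set (RSpace d)}

instance isAddHaarMeasure_subspaceLebesgue (L : Submodule ℝ (RSpace d)) :
    (subspaceLebesgue L).IsAddHaarMeasure :=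
  inferInstanceAs (stdOrthonormalBasis ℝ L).toBasis.addHaar.IsAddHaarMeasure

theorem cylinderOver_eq_preimage_projectionOnto (h : IsCompl L T) (hK : K ⊆ T) :
    cylinderOver L K = T.projectionOnto L h.symm ⁻¹' (Subtype.val ⁻¹' K) := by
  ext x
  constructor
  · rintro ⟨x₁, h₁, x₂, h₂, rfl⟩
    simpa [Submodule.projection_apply_of_mem_left h.symm (hK h₂),
      (Submodule.projection_apply_eq_zero_iff h.symm).mpr h₁] using h₂
  · intro hx
    exact ⟨x - T.projection L h.symm x, Submodule.sub_projection_mem h.symm x, _, hx,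
      (sub_add_cancel x _).symm⟩

theorem isClosed_cylinderOver (h : IsCompl L T) (hK : IsClosed K) (hKT : K ⊆ T) :
    IsClosed (cylinderOver L K) := by
  rw [cylinderOver_eq_preimage_projectionOnto h hKT]
  exact (hK.preimage continuous_subtype_val).preimage
    (LinearMap.continuous_of_finiteDimensional _)

theorem volume_cylinderOver_ne_zero (h : IsCompl L T) (hK : MeasurableSet K) (hKT : K ⊆ T)
    (hpos : 0 < subspaceLebesgue T (Subtype.val ⁻¹' K)) : volume (cylinderOver L K) ≠ 0 := by
  contrapose! hpos
  rw [cylinderOver_eq_preimage_projectionOnto h hKT, measure_eq_zero_iff_ae_notMem] at hpos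
  have hT := (ae_comp_linearMap_mem_iff (T.projectionOnto L h.symm) volume (subspaceLebesgue T)
    (Submodule.projectionOnto_surjective h.symm)
    (measurable_subtype_coe hK).compl).mp hpos
  exact (measure_eq_zero_iff_ae_notMem.mpr hT).le

theorem IsMetaplectic.essSupport_subset_cylinderOver {A B C D : Matrix (Fin d) (Fin d) ℝ}
    {U : L2Space d ≃ₗᵢ[ℂ] L2Space d} (hU : IsMetaplectic (Matrix.fromBlocks A B C D) U)
    (hK : IsClosed K) (hKT : K ⊆ transComplement B D) {f : L2Space d}
    (hf : essSupport f ⊆ cylinderOver (matKer B)ᗮ K) :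
    essSupport (U f) ⊆ cylinderOver (matRange B) (transPreimage B D K) := by
  have h := isCompl_orthogonal_matKer_transComplement hU.1
  rw [← preimage_transpose_cylinderOver hU.1 hKT]
  rw [cylinderOver_eq_preimage_projectionOnto h hKT] at hf ⊢
  let P := LinearMap.toContinuousLinearMap
    ((transComplement B D).projectionOnto (matKer B)ᗮ h.symm)
  have hP (y : RSpace d) : P (Matrix.toEuclideanLin B.transpose y) = 0 := by
    refine (Submodule.projectionOnto_apply_eq_zero_iff h.symm).mpr ?_
    rw [orthogonal_matKer]
    exact ⟨y, rfl⟩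
  exact hU.essSupport_subset_preimage (P := P) hP (hK.preimage continuous_subtype_val) hf

end Cylinder

theorem theorem4p6_general {d : ℕ} {A B C D : Matrix (Fin d) (Fin d) ℝ}
    {U : L2Space d ≃ₗᵢ[ℂ] L2Space d} (hU : IsMetaplectic (Matrix.fromBlocks A B C D) U) :
    IsCompl (matKer B)ᗮ (transComplement B D) ∧
    IsCompl (matRange B) (matRange B)ᗮ ∧
    Set.InjOn (Matrix.toEuclideanLin D.transpose) ((matRange B)ᗮ : Set (RSpace d)) ∧
    ∀ K : Set (RSpace d), IsClosed K → K ⊆ (transComplement B D : Set (RSpace d)) →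
      ∃ f : L2Space d,
        essSupport f ⊆ cylinderOver (matKer B)ᗮ K ∧
        essSupport (U f) ⊆ cylinderOver (matRange B) (transPreimage B D K) ∧
        (0 < subspaceLebesgue (transComplement B D) (Subtype.val ⁻¹' K) → f ≠ 0) := by
  have hcompl := isCompl_orthogonal_matKer_transComplement hU.1
  refine ⟨hcompl, Submodule.isCompl_orthogonal _, injOn_transpose_orthogonal_matRange hU.1,
    fun K hK hKT => ?_⟩
  have hclosed := isClosed_cylinderOver hcompl hK hKT
  obtain ⟨f, hf, hf0⟩ : ∃ f : L2Space d, essSupport f ⊆ cylinderOver (matKer B)ᗮ K ∧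
      (0 < subspaceLebesgue (transComplement B D) (Subtype.val ⁻¹' K) → f ≠ 0) := by
    by_cases hpos : 0 < subspaceLebesgue (transComplement B D) (Subtype.val ⁻¹' K)
    · have hvol := volume_cylinderOver_ne_zero hcompl hK.measurableSet hKT hpos
      obtain ⟨f, hf0, hf⟩ := exists_ne_zero_essSupport_subset hclosed hvol
      exact ⟨f, hf, fun _ => hf0⟩
    · refine ⟨0, (essSupport_subset_iff hclosed).mpr ?_, fun h => absurd h hpos⟩
      filter_upwards [Lp.coeFn_zero ℂ 2 volume] with x hx _ using hx
  exact ⟨f, hf, hU.essSupport_subset_cylinderOver hK hKT hf, hf0⟩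

theorem theorem4p6 {d : ℕ} (A B C D : Matrix (Fin d) (Fin d) ℝ)
    (U : L2Space d ≃ₗᵢ[ℂ] L2Space d)
    (hU : IsMetaplectic (Matrix.fromBlocks A B C D) U)
    (hr1 : 1 ≤ B.rank) (hrd : B.rank < d) :
    -- the components `x₂`, `ξ₂` and the inverse of `Dᵀ` on `R(B)^⊥` are well defined
    IsCompl (matKer B)ᗮ (transComplement B D) ∧
    IsCompl (matRange B) (matRange B)ᗮ ∧
    Set.InjOn (Matrix.toEuclideanLin D.transpose) ((matRange B)ᗮ : Set (RSpace d)) ∧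
    ∀ K : Set (RSpace d), IsCompact K → K ⊆ (transComplement B D : Set (RSpace d)) →
      ∃ f : L2Space d,
        essSupport f ⊆ cylinderOver (matKer B)ᗮ K ∧
        essSupport (U f) ⊆ cylinderOver (matRange B) (transPreimage B D K) ∧
        (0 < subspaceLebesgue (transComplement B D) (Subtype.val ⁻¹' K) → f ≠ 0) := by
  obtain ⟨hker, hrange, hinj, hf⟩ := theorem4p6_general hU
  exact ⟨hker, hrange, hinj, fun K hK => hf K hK.isClosed⟩
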